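/- Let $\mathcal I$ be a finite set of agents with $|\mathcal I|\ge 3$, $\Theta$ a finite set of states, and $A$ a nonempty set of pure alternatives. Let $\Delta(A)$ be the set of lotteries on $A$ with countable support and let $X=\Delta(A)\times\mathbb R^{\mathcal I}$ be the set of outcomes (a lottery together with a transfer to each agent). Each state $\theta$ determines a type $\theta_i\in\Theta_i$ of each agent $i$, and distinct states differ in the type of at least one agent. Each type $\theta_i$ has a bounded utility function $v_i(\cdot,\theta_i):A\to\mathbb R$, extended to $\Delta(A)$ by expectation, and agent $i$'s utility from $x=(\ell,(t_j)_{j})\in X$ is $u_i(x,\theta_i)=v_i(\ell,\theta_i)+t_i$. Distinct types of the same agent have different preference orderings over $\Delta(A)$, and no type is indifferent over all elements of $A$. A social choice correspondence $F$ assigns to each $\theta\in\Theta$ a nonempty finite set $F(\theta)\subseteq X$. It satisfies Maskin monotonicity if for all states $\tilde\theta,\theta$ and every $z\in F(\tilde\theta)\setminus F(\theta)$ there are an agent $i$ and an outcome $z'\in X$ with $u_i(z',\tilde\theta_i)\le u_i(z,\tilde\theta_i)$ and $u_i(z',\theta_i)>u_i(z,\theta_i)$. A finite mechanism consists of finite nonempty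 message sets $M_i$ $(i\in\mathcal I)$, an outcome function $g:M\to X$ on $M=\prod_i M_i$, and transfer rules $\tau_i:M\to\mathbb R$. In the game at state $\theta$, agent $i$'s payoff from $m\in M$ is $U_i(m,\theta)=u_i(g(m),\theta_i)+\tau_i(m)$. A correlated equilibrium of this game is a probability distribution $\sigma$ on $M$ such that for every agent $i$ and all $m_i,m_i'\in M_i$, $$\sum_{m_{-i}}\sigma(m_i,m_{-i})\,U_i((m_i,m_{-i}),\theta)\ \ge\ \sum_{m_{-i}}\sigma(m_i,m_{-i})\,U_i((m_i',m_{-i}),\theta).$$ The mechanism implements $F$ in correlated equilibria if for every $\theta\in\Theta$: (i) for every $x\in F(\theta)$ the game at $\theta$ has a pure-strategy Nash equilibrium $m$ with $g(m)=x$ and $\tau_i(m)=0$ for every agent $i$; and (ii) for every $m\in M$ that has positive probability under some correlated equilibrium of the game at $\theta$, $g(m)\in F(\theta)$ and $\tau_i(m)=0$ for every agent $i$. Theorem. There exists a finite mechanism that implements $F$ in correlated equilibria if and only if $F$ satisfies Maskin monotonicity. -/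

import Mathlib

/-- Outcomes: a lottery on the pure alternatives `A` (a `PMF` has countable support), together
with a monetary transfer to each agent. -/
abbrev Outcome (ι A : Type*) : Type _ := PMF A × (ι → ℝ)

/-- Expected value of the function `w` on pure alternatives under the lottery `ℓ`. -/
noncomputable def expectedValue {A : Type*} (w : A → ℝ) (ℓ : PMF A) : ℝ :=
  ∑' a, (ℓ a).toReal * w a

/-- An environment with agents `ι`, pure alternatives `A`, states `Θ` and type sets `T i`. -/
structure Environment (ι A Θ : Type*) (T : ι → Type*) where
  /-- The type profile induced by a state. -/
  typeOf : Θ → ∀ i, T i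
  /-- No redundancy: distinct states differ in the type of some agent. -/
  typeOf_injective : Function.Injective typeOf
  /-- Utility of agent `i` of type `t` from a pure alternative. -/
  util : ∀ i, T i → A → ℝ
  /-- Utilities are bounded. -/
  util_bounded : ∀ i t, ∃ C : ℝ, ∀ a, |util i t a| ≤ C
  /-- Distinct types of an agent have different preference orderings over lotteries. -/
  util_distinct : ∀ i (t t' : T i), t ≠ t' →
    ¬ ∀ ℓ ℓ' : PMF A, expectedValue (util i t) ℓ ≤ expectedValue (util i t) ℓ' ↔
      expectedValue (util i t') ℓ ≤ expectedValue (util i t') ℓ'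
  /-- No type is indifferent over all pure alternatives. -/
  util_not_indifferent : ∀ i t, ∃ a b, util i t a ≠ util i t b

/-- Quasilinear utility of agent `i` from the outcome `x` in the state `θ`. -/
noncomputable def Environment.u {ι A Θ : Type*} {T : ι → Type*} (E : Environment ι A Θ T)
    (i : ι) (x : Outcome ι A) (θ : Θ) : ℝ :=
  expectedValue (E.util i (E.typeOf θ i)) x.1 + x.2 i

/-- Maskin monotonicity of the social choice correspondence `F`. -/
def MaskinMonotonic {ι A Θ : Type*} {T : ι → Type*} (E : Environment ι A Θ T)
    (F : Θ → Set (Outcome ι A)) : Prop :=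
  ∀ (θ' θ : Θ), ∀ z ∈ F θ', z ∉ F θ →
    ∃ (i : ι) (z' : Outcome ι A), E.u i z' θ' ≤ E.u i z θ' ∧ E.u i z θ < E.u i z' θ

/-- A finite mechanism: finite nonempty message sets, an outcome function and transfer rules.
(Message sets in `Type` are no restriction, as they are finite.) -/
structure FiniteMechanism (ι A : Type*) where
  /-- The messages available to each agent. -/
  Msg : ι → Type
  [fintypeMsg : ∀ i, Fintype (Msg i)]
  [nonemptyMsg : ∀ i, Nonempty (Msg i)]
  /-- The outcome function. -/
  g : (∀ i, Msg i) → Outcome ι A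
  /-- The transfer rule of each agent. -/
  τ : ι → (∀ i, Msg i) → ℝ

attribute [instance] FiniteMechanism.fintypeMsg FiniteMechanism.nonemptyMsg

namespace FiniteMechanism

variable {ι A Θ : Type*} {T : ι → Type*}

/-- The payoff of agent `i` from the message profile `m` in the game at the state `θ`. -/
noncomputable def payoff (M : FiniteMechanism ι A) (E : Environment ι A Θ T) (θ : Θ)
    (i : ι) (m : ∀ i, M.Msg i) : ℝ :=
  E.u i (M.g m) θ + M.τ i m

/-- `m` is a pure-strategy Nash equilibrium of the game at the state `θ`. -/
def IsPureNash [DecidableEq ι] (M : FiniteMechanism ι A) (E : Environment ι A Θ T) (θ : Θ)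
    (m : ∀ i, M.Msg i) : Prop :=
  ∀ (i : ι) (b : M.Msg i), M.payoff E θ i (Function.update m i b) ≤ M.payoff E θ i m

open Classical in
/-- The probability distribution `σ` on message profiles is a correlated equilibrium of the game
at the state `θ`: no agent gains from replacing a recommended message `a` by a message `b`. -/
def IsCorrelatedEquilibrium [Fintype ι] [DecidableEq ι] (M : FiniteMechanism ι A)
    (E : Environment ι A Θ T) (θ : Θ) (σ : (∀ i, M.Msg i) → ℝ) : Prop :=
  σ ∈ stdSimplex ℝ (∀ i, M.Msg i) ∧
    ∀ (i : ι) (a b : M.Msg i),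
      ∑ m with m i = a, σ m * M.payoff E θ i (Function.update m i b) ≤
        ∑ m with m i = a, σ m * M.payoff E θ i m

/-- The mechanism implements the correspondence `F` in correlated equilibria. -/
def Implements [Fintype ι] [DecidableEq ι] (M : FiniteMechanism ι A) (E : Environment ι A Θ T)
    (F : Θ → Set (Outcome ι A)) : Prop :=
  ∀ θ : Θ,
    (∀ x ∈ F θ, ∃ m, M.IsPureNash E θ m ∧ M.g m = x ∧ ∀ i, M.τ i m = 0) ∧
    (∀ m, (∃ σ, M.IsCorrelatedEquilibrium E θ σ ∧ 0 < σ m) →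
      M.g m ∈ F θ ∧ ∀ i, M.τ i m = 0)

end FiniteMechanism

/-- `F` is implementable in correlated equilibria by a finite mechanism. -/
def ImplementableInCorrelatedEquilibria {ι A Θ : Type*} {T : ι → Type*} [Fintype ι]
    [DecidableEq ι] (E : Environment ι A Θ T) (F : Θ → Set (Outcome ι A)) : Prop :=
  ∃ M : FiniteMechanism ι A, M.Implements E F

/-! Necessity: if `z` lies in `F θ'` but not in `F θ`, the equilibrium yielding `z` at `θ'` is no
equilibrium at `θ`. The outcome of a deviation profitable at `θ`, with the deviator's transfer
added, is the preference reversal.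

Sufficiency: single out agents `e₁`, `e₂`, `e₃`. The proposal endorsed alike by `e₂` and `e₃` is
selected, failing that the one of `e₁`. It is contested if some type, reported by its owner or by
`e₃`, has a preference reversal against it. A contest replaces the outcome by one that rewards true
reports (`ContestScheme.nonempty`), fines `e₃` if his report about the others mismatches theirs, and
penalizes `e₁` (`e₂` for an endorsement) if the reports of `e₃` alone contest the proposal.

A modification of messages that never hurts on the support of a correlated equilibrium never helps
there (`payoff_update_le`). This is applied repeatedly, each time using what is already known on the
support. Own types are true in every contest, and an uncontested proposal meets no true objection;
hence `e₃` reports the others truly in every contest and his judgement is correct; hence no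
objectionable endorsement takes effect; hence `e₁` makes no objectionable proposal that is selected.
No contest remains (`not_contested_of_support`), and monotonicity puts the outcome in `F θ`.
Conversely, under unanimous truth no single agent can move the selection
(`profilePayoff_update_le`). -/

open Filter Topology

/-! ### Expected values of compound lotteries -/

theorem summable_toReal_mul {A : Type*} {w : A → ℝ} {C : ℝ} (hw : ∀ a, |w a| ≤ C) (ℓ : PMF A) :
    Summable fun a => (ℓ a).toReal * w a := by
  have h : Summable fun a => (ℓ a).toReal * C :=
    (ENNReal.summable_toReal ℓ.tsum_coe_ne_top).mul_right C
  refine Summable.of_norm_bounded h fun a => ?_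
  rw [norm_mul, Real.norm_of_nonneg ENNReal.toReal_nonneg, Real.norm_eq_abs]
  exact mul_le_mul_of_nonneg_left (hw a) ENNReal.toReal_nonneg

/-- The expected value of a compound lottery. -/
theorem expectedValue_bind {A J : Type*} [Fintype J] {w : A → ℝ} {C : ℝ} (hw : ∀ a, |w a| ≤ C)
    (p : PMF J) (f : J → PMF A) :
    expectedValue w (p.bind f) = ∑ j, (p j).toReal * expectedValue w (f j) := by
  have hpt : ∀ a, ((p.bind f) a).toReal * w a =
      ∑ j, (p j).toReal * ((f j a).toReal * w a) := by
    intro a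
    rw [PMF.bind_apply, tsum_fintype, ENNReal.toReal_sum, Finset.sum_mul]
    · exact Finset.sum_congr rfl fun j _ => by rw [ENNReal.toReal_mul, mul_assoc]
    · exact fun j _ => ENNReal.mul_ne_top (p.apply_ne_top j) ((f j).apply_ne_top a)
  unfold expectedValue
  simp_rw [hpt, ← tsum_mul_left]
  exact Summable.tsum_finsetSum fun j _ => (summable_toReal_mul hw (f j)).mul_left _

/-! ### Mixtures, menus that elicit types, and challenges -/

namespace Environment

variable {ι A Θ : Type*} {T : ι → Type*} (E : Environment ι A Θ T)

theorem u_congr {i : ι} {θ θ' : Θ} (h : E.typeOf θ i = E.typeOf θ' i) (x : Outcome ι A) :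
    E.u i x θ = E.u i x θ' := by
  simp only [u, h]

/-- Outcomes can be mixed, and utilities are affine in the mixture. -/
theorem exists_mixture {J : Type*} [Fintype J] (w : J → ℝ) (hw : ∀ j, 0 ≤ w j)
    (hsum : ∑ j, w j = 1) (Z : J → Outcome ι A) :
    ∃ y : Outcome ι A, ∀ i θ, E.u i y θ = ∑ j, w j * E.u i (Z j) θ := by
  have h1 : ∑ j, ENNReal.ofReal (w j) = 1 := by
    rw [← ENNReal.ofReal_sum_of_nonneg fun j _ => hw j, hsum, ENNReal.ofReal_one]
  refine ⟨((PMF.ofFintype _ h1).bind fun j => (Z j).1, fun i => ∑ j, w j * (Z j).2 i),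
    fun i θ => ?_⟩
  obtain ⟨C, hC⟩ := E.util_bounded i (E.typeOf θ i)
  simp only [u, expectedValue_bind hC, PMF.ofFintype_apply, ENNReal.toReal_ofReal (hw _),
    mul_add, Finset.sum_add_distrib]

theorem exists_average {J : Type*} [Fintype J] [Nonempty J] (Z : J → Outcome ι A) :
    ∃ y : Outcome ι A, ∀ i θ, E.u i y θ = (Fintype.card J : ℝ)⁻¹ * ∑ j, E.u i (Z j) θ := by
  have h : (Fintype.card J : ℝ) ≠ 0 := by exact_mod_cast Fintype.card_ne_zero
  obtain ⟨y, hy⟩ := E.exists_mixture (fun _ : J => (Fintype.card J : ℝ)⁻¹)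
    (fun _ => by positivity) (by simp [h]) Z
  exact ⟨y, fun i θ => by rw [hy, Finset.mul_sum]⟩

theorem exists_segment {ε : ℝ} (h0 : 0 ≤ ε) (h1 : ε ≤ 1) (y z : Outcome ι A) :
    ∃ x : Outcome ι A, ∀ i θ, E.u i x θ = (1 - ε) * E.u i y θ + ε * E.u i z θ := by
  obtain ⟨x, hx⟩ := E.exists_mixture (fun b : Bool => if b then ε else 1 - ε)
    (fun b => by cases b <;> simp <;> linarith) (by simp) (fun b => if b then z else y)
  exact ⟨x, fun i θ => by rw [hx]; simp; ring⟩

theorem exists_shift (z : Outcome ι A) (c : ℝ) :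
    ∃ z' : Outcome ι A, ∀ i θ, E.u i z' θ = E.u i z θ + c :=
  ⟨(z.1, fun i => z.2 i + c), fun i θ => by simp only [u]; ring⟩

/-- A binary choice between outcomes, on which two different types of an agent disagree
strictly. -/
theorem exists_separating_pair {i : ι} {θ θ' : Θ} (h : E.typeOf θ i ≠ E.typeOf θ' i) :
    ∃ y z : Outcome ι A, E.u i z θ < E.u i y θ ∧ E.u i y θ' < E.u i z θ' := by
  have key : ∃ ℓ ℓ' : PMF A,
      expectedValue (E.util i (E.typeOf θ i)) ℓ - expectedValue (E.util i (E.typeOf θ i)) ℓ' ≠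
      expectedValue (E.util i (E.typeOf θ' i)) ℓ - expectedValue (E.util i (E.typeOf θ' i)) ℓ' := by
    by_contra! hc
    refine E.util_distinct i _ _ h fun ℓ ℓ' => ?_
    have := hc ℓ ℓ'
    constructor <;> intro <;> linarith
  obtain ⟨ℓ, ℓ', hne⟩ := key
  wlog hlt : expectedValue (E.util i (E.typeOf θ' i)) ℓ -
      expectedValue (E.util i (E.typeOf θ' i)) ℓ' <
      expectedValue (E.util i (E.typeOf θ i)) ℓ -
      expectedValue (E.util i (E.typeOf θ i)) ℓ' generalizing ℓ ℓ'
  · refine this ℓ' ℓ (fun hc => hne (by linarith)) ?_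
    have := lt_of_le_of_ne (not_lt.1 hlt) hne
    linarith
  -- A transfer strictly between the two utility differences, attached to `ℓ'`, reverses the
  -- preferences.
  obtain ⟨c, hc1, hc2⟩ := exists_between hlt
  exact ⟨(ℓ, fun _ => 0), (ℓ', fun _ => c), by simp only [u]; linarith, by simp only [u]; linarith⟩

/-- A menu of outcomes, indexed by reported states, from which each agent strictly prefers to
choose according to his own type. -/
theorem exists_dictator_menu [Finite Θ] (i : ι) :
    ∃ D : Θ → Outcome ι A, (∀ θ t, E.u i (D t) θ ≤ E.u i (D θ) θ) ∧
      ∀ θ t, E.typeOf t i ≠ E.typeOf θ i → E.u i (D t) θ < E.u i (D θ) θ := by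
  classical
  cases isEmpty_or_nonempty Θ with
  | inl h => exact ⟨fun t => h.elim t, fun θ => h.elim θ, fun θ => h.elim θ⟩
  | inr h =>
    have := Fintype.ofFinite Θ
    by_cases hJ : Nonempty {p : Θ × Θ // E.typeOf p.1 i ≠ E.typeOf p.2 i}
    · choose y z hy hz using fun p : {p : Θ × Θ // E.typeOf p.1 i ≠ E.typeOf p.2 i} =>
        E.exists_separating_pair p.2
      choose D hD using fun t => E.exists_average
        (fun p => if E.u i (z p) t < E.u i (y p) t then y p else z p)
      have hpos : (0 : ℝ) < (Fintype.card {p : Θ × Θ // E.typeOf p.1 i ≠ E.typeOf p.2 i} : ℝ)⁻¹ :=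
        inv_pos.2 (by exact_mod_cast Fintype.card_pos)
      have hle : ∀ θ t p, E.u i (if E.u i (z p) t < E.u i (y p) t then y p else z p) θ ≤
          E.u i (if E.u i (z p) θ < E.u i (y p) θ then y p else z p) θ := by
        intro θ t p
        split_ifs <;> linarith
      refine ⟨D, fun θ t => ?_, fun θ t hne => ?_⟩
      · rw [hD, hD]
        exact mul_le_mul_of_nonneg_left (Finset.sum_le_sum fun p _ => hle θ t p) hpos.le
      · rw [hD, hD]
        -- The pair built to separate `θ` from `t` gives the strict term: there the two reports
        -- select different outcomes.
        refine mul_lt_mul_of_pos_left (Finset.sum_lt_sum (fun p _ => hle θ t p)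
          ⟨⟨(θ, t), fun h => hne h.symm⟩, Finset.mem_univ _, ?_⟩) hpos
        have h1 := hy ⟨(θ, t), fun h => hne h.symm⟩
        have h2 := hz ⟨(θ, t), fun h => hne h.symm⟩
        rw [if_neg (not_lt.2 h2.le), if_pos h1]
        exact h1
    -- All states give `i` the same type, so a constant menu will do; non-indifference only supplies
    -- an element of `A`.
    · obtain ⟨y, -⟩ : ∃ y : Outcome ι A, True := by
        obtain ⟨a, -⟩ := E.util_not_indifferent i (E.typeOf h.some i)
        exact ⟨(PMF.pure a, 0), trivial⟩
      exact ⟨fun _ => y, fun _ _ => le_rfl, fun θ t hne => (hJ ⟨⟨(t, θ), hne⟩⟩).elim⟩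

/-- An agent with the type of the state `t` can challenge the outcome `x` proposed for the
state `s`: his preferences over some outcome and `x` are reversed. -/
def Challenges (i : ι) (s : Θ) (x : Outcome ι A) (t : Θ) : Prop :=
  ∃ z, E.u i z s ≤ E.u i x s ∧ E.u i x t < E.u i z t

theorem challenges_congr {i : ι} {s t t' : Θ} {x : Outcome ι A}
    (h : E.typeOf t i = E.typeOf t' i) : E.Challenges i s x t ↔ E.Challenges i s x t' := by
  simp only [Challenges, E.u_congr h]

theorem not_challenges_self (i : ι) (s : Θ) (x : Outcome ι A) : ¬ E.Challenges i s x s :=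
  fun ⟨_, h1, h2⟩ => absurd h1 (not_le.2 h2)

variable {E} in
theorem Challenges.exists_strict {i : ι} {s t : Θ} {x : Outcome ι A} (h : E.Challenges i s x t) :
    ∃ z, E.u i z s < E.u i x s ∧ E.u i x t < E.u i z t := by
  obtain ⟨z, h1, h2⟩ := h
  obtain ⟨c, hc0, hc⟩ := exists_between (sub_pos.2 h2)
  obtain ⟨z', hz'⟩ := E.exists_shift z (-c)
  exact ⟨z', by rw [hz']; linarith, by rw [hz']; linarith⟩

/-- Otherwise raising `z` by its utility gap to `x` at `s` would give indifference at `s` and strict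
preference at `θ`, a challenge. -/
theorem u_lt_of_not_challenges {i : ι} {s θ : Θ} {x z : Outcome ι A}
    (h : ¬ E.Challenges i s x θ) (hz : E.u i z s < E.u i x s) : E.u i z θ < E.u i x θ := by
  obtain ⟨z', hz'⟩ := E.exists_shift z (E.u i x s - E.u i z s)
  by_contra! hc
  exact h ⟨z', by rw [hz']; linarith, by rw [hz']; linarith⟩

/-- A best challenge for every reported type: reporting one's own type is optimal, challenges are
strictly profitable for types that can challenge and strictly costly for the others. -/
theorem exists_best_challenge [Finite Θ] (i : ι) (s : Θ) (x : Outcome ι A) :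
    ∃ B : Θ → Outcome ι A, (∀ t, ¬ E.Challenges i s x t → B t = x) ∧
      (∀ t, E.Challenges i s x t → E.u i x t < E.u i (B t) t) ∧
      (∀ θ t, ¬ E.Challenges i s x θ → E.Challenges i s x t → E.u i (B t) θ < E.u i x θ) ∧
      ∀ θ t, E.u i (B t) θ ≤ E.u i (B θ) θ := by
  classical
  choose z hz1 hz2 using fun p : {t // E.Challenges i s x t} => p.2.exists_strict
  have hmax : ∀ t : {t // E.Challenges i s x t}, ∃ p, ∀ q, E.u i (z q) t ≤ E.u i (z p) t := by
    intro t
    have : Nonempty {t // E.Challenges i s x t} := ⟨t⟩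
    exact Finite.exists_max fun q => E.u i (z q) t
  choose b hb using hmax
  have hpos : ∀ t (h : E.Challenges i s x t), E.u i x t < E.u i (z (b ⟨t, h⟩)) t :=
    fun t h => (hz2 ⟨t, h⟩).trans_le (hb ⟨t, h⟩ ⟨t, h⟩)
  refine ⟨fun t => if h : E.Challenges i s x t then z (b ⟨t, h⟩) else x, fun t h => dif_neg h,
    fun t h => ?_, fun θ t h h' => ?_, fun θ t => ?_⟩
  · simpa only [dif_pos h] using hpos t h
  · simpa only [dif_pos h'] using E.u_lt_of_not_challenges h (hz1 _)
  · by_cases ht : E.Challenges i s x t <;> by_cases hθ : E.Challenges i s x θ <;>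
      simp only [ht, hθ, dite_true, dite_false]
    · exact hb ⟨θ, hθ⟩ _
    · exact (E.u_lt_of_not_challenges hθ (hz1 _)).le
    · exact (hpos θ hθ).le
    · exact le_rfl

end Environment

/-! ### Proposals and contest outcomes -/

/-- A proposal: a state together with an outcome that is socially desirable in it. -/
abbrev Proposal {Θ X : Type*} (F : Θ → Set X) : Type _ := {p : Θ × X // p.2 ∈ F p.1}

theorem Proposal.finite {Θ X : Type*} [Finite Θ] {F : Θ → Set X} (hF : ∀ θ, (F θ).Finite) :
    Finite (Proposal F) := by
  have := fun θ => (hF θ).to_subtype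
  exact Finite.of_injective (β := Σ θ, F θ) (fun p => ⟨p.1.1, p.1.2, p.2⟩) (by
    rintro ⟨⟨s, x⟩, hx⟩ ⟨⟨s', x'⟩, hx'⟩ h
    simp only [Sigma.mk.injEq] at h
    obtain ⟨rfl, h⟩ := h
    simp only [heq_eq_eq, Subtype.mk.injEq] at h
    subst h
    rfl)

/-- Agent `i`, when he has the type of the state `t`, can challenge the proposal `a`. -/
abbrev Environment.Objects {ι A Θ : Type*} {T : ι → Type*} (E : Environment ι A Θ T)
    {F : Θ → Set (Outcome ι A)} (i : ι) (a : Proposal F) (t : Θ) : Prop :=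
  E.Challenges i a.1.1 a.1.2 t

/-- Outcomes for contested proposals, as functions of the reported types, together with a small
fine and a large penalty. -/
structure ContestScheme {ι A Θ : Type*} {T : ι → Type*} [DecidableEq ι] (E : Environment ι A Θ T)
    (F : Θ → Set (Outcome ι A)) where
  /-- The outcome when the proposal `a` is contested and the types of `t` are reported. -/
  contested : Proposal F → (ι → Θ) → Outcome ι A
  /-- The small fine. -/
  fine : ℝ
  /-- The large penalty. -/
  penalty : ℝ
  fine_pos : 0 < fine
  truth_weak : ∀ i a t θ,
    E.u i (contested a t) θ ≤ E.u i (contested a (Function.update t i θ)) θ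
  truth_strict : ∀ i a t θ, E.typeOf (t i) i ≠ E.typeOf θ i →
    E.u i (contested a t) θ < E.u i (contested a (Function.update t i θ)) θ
  -- The margin covers the fine that `e₃` may incur when his own challenge starts a contest.
  challenge_pays : ∀ i a t, E.Objects i a (t i) → (∀ j ≠ i, ¬ E.Objects j a (t j)) →
    E.u i a.1.2 (t i) + fine < E.u i (contested a t) (t i)
  false_challenge_costs : ∀ i a t θ, ¬ E.Objects i a θ → E.Objects i a (t i) →
    (∀ j ≠ i, ¬ E.Objects j a (t j)) → E.u i (contested a t) θ < E.u i a.1.2 θ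
  -- Bounds what `e₃` can gain from a contest caused only by his report about the others, so that
  -- the fine deters it.
  unchallenged : ∀ i a t θ, (∀ j, ¬ E.Objects j a (t j)) →
    E.u i (contested a t) θ < E.u i a.1.2 θ + fine
  penalty_contested : ∀ i a t a' t' θ,
    E.u i (contested a t) θ < E.u i (contested a' t') θ + penalty
  penalty_uncontested : ∀ i a t (a' : Proposal F) θ,
    E.u i (contested a t) θ < E.u i a'.1.2 θ + penalty

/-- The contested outcome is `1 - ε` times the average of all agents' best challenges plus `ε` times
the average of their dictator menus; the latter makes truth strict. The constants are chosen in
turn: the fine `κ` below every challenger's gain, then `ε` small relative to `κ`, and last the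
penalty above finitely many utility differences. -/
theorem ContestScheme.nonempty {ι A Θ : Type*} {T : ι → Type*} [Fintype ι] [DecidableEq ι]
    [Nonempty ι] [Finite Θ] (E : Environment ι A Θ T) {F : Θ → Set (Outcome ι A)}
    (hF : ∀ θ, (F θ).Finite) : Nonempty (ContestScheme E F) := by
  have := Proposal.finite hF
  choose D hDweak hDstrict using E.exists_dictator_menu
  choose B hBx hBpos hBneg hBtruth using
    fun i (a : Proposal F) => E.exists_best_challenge i a.1.1 a.1.2
  choose avgB havgB using fun (a : Proposal F) (t : ι → Θ) =>
    E.exists_average fun j => B j a (t j)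
  choose avgD havgD using fun t : ι → Θ => E.exists_average fun j => D j (t j)
  set c : ℝ := (Fintype.card ι : ℝ)⁻¹
  have hcard : (Fintype.card ι : ℝ) ≠ 0 := by exact_mod_cast Fintype.card_ne_zero
  have hcpos : 0 < c := inv_pos.2 (by exact_mod_cast Fintype.card_pos)
  -- Agents who do not challenge contribute the proposed outcome itself, so only the share `c` of
  -- agent `i` deviates from it.
  have hone : ∀ i a (t : ι → Θ) θ, (∀ j ≠ i, ¬ E.Objects j a (t j)) →
      E.u i (avgB a t) θ = E.u i a.1.2 θ + c * (E.u i (B i a (t i)) θ - E.u i a.1.2 θ) := by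
    intro i a t θ h
    have : ∀ j, E.u i (B j a (t j)) θ =
        E.u i a.1.2 θ + if j = i then E.u i (B i a (t i)) θ - E.u i a.1.2 θ else 0 := by
      intro j
      split_ifs with hj
      · subst hj; ring
      · rw [hBx j a _ (h j hj), add_zero]
    rw [havgB, Finset.sum_congr rfl fun j _ => this j, Finset.sum_add_distrib, Finset.sum_const,
      Finset.card_univ, nsmul_eq_mul, Finset.sum_ite_eq', if_pos (Finset.mem_univ i),
      mul_add, ← mul_assoc, inv_mul_cancel₀ hcard, one_mul]
  have hBupd : ∀ i a (t : ι → Θ) θ,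
      E.u i (avgB a t) θ ≤ E.u i (avgB a (Function.update t i θ)) θ := by
    intro i a t θ
    rw [havgB, havgB]
    refine mul_le_mul_of_nonneg_left (Finset.sum_le_sum fun j _ => ?_) hcpos.le
    by_cases hj : j = i
    · subst hj; simpa using hBtruth j a θ (t j)
    · rw [Function.update_of_ne hj]
  have hDupd : ∀ i (t : ι → Θ) θ,
      E.u i (avgD t) θ ≤ E.u i (avgD (Function.update t i θ)) θ := by
    intro i t θ
    rw [havgD, havgD]
    refine mul_le_mul_of_nonneg_left (Finset.sum_le_sum fun j _ => ?_) hcpos.le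
    by_cases hj : j = i
    · subst hj; simpa using hDweak j θ (t j)
    · rw [Function.update_of_ne hj]
  have hDupd' : ∀ i (t : ι → Θ) θ, E.typeOf (t i) i ≠ E.typeOf θ i →
      E.u i (avgD t) θ < E.u i (avgD (Function.update t i θ)) θ := by
    intro i t θ h
    rw [havgD, havgD]
    refine mul_lt_mul_of_pos_left (Finset.sum_lt_sum (fun j _ => ?_)
      ⟨i, Finset.mem_univ _, by simpa using hDstrict i θ (t i) h⟩) hcpos
    by_cases hj : j = i
    · subst hj; simpa using hDweak j θ (t j)
    · rw [Function.update_of_ne hj]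
  obtain ⟨κ, hκ0, hκ⟩ : ∃ κ : ℝ, 0 < κ ∧ ∀ i (a : Proposal F) θ, E.Objects i a θ →
      κ < c * (E.u i (B i a θ) θ - E.u i a.1.2 θ) := by
    have h : ∀ᶠ κ : ℝ in 𝓝[>] 0, ∀ i (a : Proposal F) θ, E.Objects i a θ →
        κ < c * (E.u i (B i a θ) θ - E.u i a.1.2 θ) := by
      simp only [eventually_all]
      exact fun i a θ h => nhdsWithin_le_nhds <|
        gt_mem_nhds (mul_pos hcpos (sub_pos.2 (hBpos i a θ h)))
    obtain ⟨κ, hκ, hκ0⟩ := (h.and self_mem_nhdsWithin).exists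
    exact ⟨κ, hκ0, hκ⟩
  have hlim : ∀ p q : ℝ, Tendsto (fun ε : ℝ => (1 - ε) * p + ε * q) (𝓝[>] 0) (𝓝 p) := by
    intro p q
    have : Tendsto (fun ε : ℝ => (1 - ε) * p + ε * q) (𝓝 0) (𝓝 ((1 - 0) * p + 0 * q)) :=
      Continuous.tendsto (by fun_prop) 0
    simp only [sub_zero, one_mul, zero_mul, add_zero] at this
    exact this.mono_left nhdsWithin_le_nhds
  obtain ⟨ε, hε0, hε1, hpays, hcosts, hsmall⟩ : ∃ ε : ℝ, 0 < ε ∧ ε < 1 ∧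
      (∀ i (a : Proposal F) (t : ι → Θ), E.Objects i a (t i) → (∀ j ≠ i, ¬ E.Objects j a (t j)) →
        E.u i a.1.2 (t i) + κ <
          (1 - ε) * E.u i (avgB a t) (t i) + ε * E.u i (avgD t) (t i)) ∧
      (∀ i (a : Proposal F) (t : ι → Θ) θ, ¬ E.Objects i a θ → E.Objects i a (t i) →
        (∀ j ≠ i, ¬ E.Objects j a (t j)) →
        (1 - ε) * E.u i (avgB a t) θ + ε * E.u i (avgD t) θ < E.u i a.1.2 θ) ∧
      (∀ i (a : Proposal F) (t : ι → Θ) θ, (∀ j, ¬ E.Objects j a (t j)) →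
        (1 - ε) * E.u i (avgB a t) θ + ε * E.u i (avgD t) θ < E.u i a.1.2 θ + κ) := by
    -- The three utility inequalities are strict at `ε = 0` and finitely many, so they persist for
    -- small positive `ε`.
    refine Eventually.exists (f := 𝓝[>] (0 : ℝ)) ?_
    refine Eventually.and self_mem_nhdsWithin (Eventually.and
      (nhdsWithin_le_nhds (gt_mem_nhds one_pos)) (Eventually.and ?_ (Eventually.and ?_ ?_))) <;>
    simp only [eventually_all]
    · intro i a t h h'
      refine (hlim _ _).eventually (lt_mem_nhds ?_)
      rw [hone i a t _ h']
      linarith [hκ i a _ h]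
    · intro i a t θ hθ h h'
      refine (hlim _ _).eventually (gt_mem_nhds ?_)
      rw [hone i a t _ h']
      nlinarith [hBneg i a θ _ hθ h]
    · intro i a t θ h
      refine (hlim _ _).eventually (gt_mem_nhds ?_)
      rw [hone i a t _ fun j _ => h j, hBx i a _ (h i)]
      linarith
  choose G hG using fun (a : Proposal F) (t : ι → Θ) =>
    E.exists_segment hε0.le hε1.le (avgB a t) (avgD t)
  obtain ⟨K, hK1, hK2⟩ : ∃ K : ℝ,
      (∀ i a t a' t' θ, E.u i (G a t) θ - E.u i (G a' t') θ < K) ∧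
      (∀ i a t (a' : Proposal F) θ, E.u i (G a t) θ - E.u i a'.1.2 θ < K) := by
    refine Eventually.exists (f := atTop) (Eventually.and ?_ ?_) <;>
    simp only [eventually_all]
    · exact fun _ _ _ _ _ _ => eventually_gt_atTop _
    · exact fun _ _ _ _ _ => eventually_gt_atTop _
  exact ⟨{
    contested := G
    fine := κ
    penalty := K
    fine_pos := hκ0
    truth_weak := fun i a t θ => by
      rw [hG, hG]
      exact add_le_add (mul_le_mul_of_nonneg_left (hBupd i a t θ) (by linarith))
        (mul_le_mul_of_nonneg_left (hDupd i t θ) hε0.le)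
    truth_strict := fun i a t θ h => by
      rw [hG, hG]
      exact add_lt_add_of_le_of_lt (mul_le_mul_of_nonneg_left (hBupd i a t θ) (by linarith))
        (mul_lt_mul_of_pos_left (hDupd' i t θ h) hε0)
    challenge_pays := fun i a t h h' => by rw [hG]; exact hpays i a t h h'
    false_challenge_costs := fun i a t θ hθ h h' => by rw [hG]; exact hcosts i a t θ hθ h h'
    unchallenged := fun i a t θ h => by rw [hG]; exact hsmall i a t θ h
    penalty_contested := fun i a t a' t' θ => by linarith [hK1 i a t a' t' θ]
    penalty_uncontested := fun i a t a' θ => by linarith [hK2 i a t a' θ] }⟩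

/-! ### Messages, charges and payoffs -/

/-- A message: a report of one's own type (as the component of a state), a proposal, possibly an
endorsement of a proposal, and a report of the types of the other agents. -/
structure Message (Θ N : Type*) where
  /-- The report of one's own type. -/
  own : Θ
  /-- The proposal. -/
  proposal : N
  /-- The endorsed proposal, if any. -/
  endorsement : Option N
  /-- The report of the types of the other agents. -/
  cross : Θ

instance {Θ N : Type*} [Finite Θ] [Finite N] : Finite (Message Θ N) :=
  Finite.of_injective (β := Θ × N × Option N × Θ)
    (fun m => (m.own, m.proposal, m.endorsement, m.cross)) (by
      rintro ⟨⟩ ⟨⟩ h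
      simp only [Prod.mk.injEq] at h
      obtain ⟨rfl, rfl, rfl, rfl⟩ := h
      rfl)

theorem comp_update_apply {ι M β : Type*} [DecidableEq ι] (f : M → β) (μ : ι → M) (i : ι) (b : M) :
    (fun j => f (Function.update μ i b j)) = Function.update (fun j => f (μ j)) i (f b) :=
  Function.comp_update f μ i b

namespace ContestScheme

variable {ι A Θ : Type*} {T : ι → Type*} {E : Environment ι A Θ T} {F : Θ → Set (Outcome ι A)}
  (e₁ e₂ e₃ : ι)

variable (E) in
/-- The proposal `a` is contested by the reports of own types or by the report `r` of agent `e₃`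
about the other agents. -/
def Contested (a : Proposal F) (own : ι → Θ) (r : Θ) : Prop :=
  (∃ j, E.Objects j a (own j)) ∨ ∃ j ≠ e₃, E.Objects j a r

variable (E) in
/-- The proposal `a` is contested by the reports of agent `e₃` alone. -/
def Judged (a : Proposal F) (own : ι → Θ) (r : Θ) : Prop :=
  E.Objects e₃ a (own e₃) ∨ ∃ j ≠ e₃, E.Objects j a r

variable (E) in
/-- The report `r` of agent `e₃` does not match the reports of the other agents. -/
def Mismatch (own : ι → Θ) (r : Θ) : Prop :=
  ∃ j ≠ e₃, E.typeOf r j ≠ E.typeOf (own j) j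

variable {e₃} in
theorem Judged.contested {a : Proposal F} {own : ι → Θ} {r : Θ} (h : Judged E e₃ a own r) :
    Contested E e₃ a own r :=
  h.imp_left fun h => ⟨_, h⟩

open Classical in
/-- The proposal endorsed by both `e₂` and `e₃`, if any. -/
noncomputable def endorsed (endorse : ι → Option (Proposal F)) : Option (Proposal F) :=
  if endorse e₂ = endorse e₃ then endorse e₂ else none

variable [DecidableEq ι] (M : ContestScheme E F)

open Classical in
/-- The outcome when the proposal `a` is selected. -/
noncomputable def outcome (a : Proposal F) (own : ι → Θ) (r : Θ) : Outcome ι A :=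
  if Contested E e₃ a own r then M.contested a own else a.1.2

open Classical in
/-- The charge of an agent: the author of a proposal that `e₃` contests pays the penalty, and
`e₃` pays the fine for a mismatched report when the selected proposal is contested. -/
noncomputable def charge (i : ι) (en : Option (Proposal F)) (p : Proposal F) (own : ι → Θ)
    (r : Θ) : ℝ :=
  if i = e₁ then if en = none ∧ Judged E e₃ p own r then M.penalty else 0
  else if i = e₂ then if ∃ a, en = some a ∧ Judged E e₃ a own r then M.penalty else 0
  else if i = e₃ then
    if Contested E e₃ (en.getD p) own r ∧ Mismatch E e₃ own r then M.fine else 0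
  else 0

/-- The payoff of an agent in terms of the data extracted from the message profile. -/
noncomputable def value (i : ι) (θ : Θ) (en : Option (Proposal F)) (p : Proposal F)
    (own : ι → Θ) (r : Θ) : ℝ :=
  E.u i (M.outcome e₃ (en.getD p) own r) θ - M.charge e₁ e₂ e₃ i en p own r

variable {e₁ e₂ e₃} {i : ι} {θ r : Θ} {en : Option (Proposal F)} {p a : Proposal F}
  {own : ι → Θ}

theorem outcome_of_contested (h : Contested E e₃ a own r) :
    M.outcome e₃ a own r = M.contested a own := if_pos h

theorem outcome_of_not_contested (h : ¬ Contested E e₃ a own r) :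
    M.outcome e₃ a own r = a.1.2 := if_neg h

/-- Every charge presupposes a contest of the selected proposal, because `Judged` implies
`Contested`. -/
theorem charge_of_not_contested (h : ¬ Contested E e₃ (en.getD p) own r) :
    M.charge e₁ e₂ e₃ i en p own r = 0 := by
  unfold charge
  have h1 : ¬ (en = none ∧ Judged E e₃ p own r) := by
    rintro ⟨rfl, hj⟩
    exact h hj.contested
  have h2 : ¬ ∃ a, en = some a ∧ Judged E e₃ a own r := by
    rintro ⟨a, rfl, hj⟩
    exact h hj.contested
  simp only [h, h1, h2, false_and, if_false, ite_self]

theorem value_of_not_contested (h : ¬ Contested E e₃ (en.getD p) own r) :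
    M.value e₁ e₂ e₃ i θ en p own r = E.u i (en.getD p).1.2 θ := by
  rw [value, M.outcome_of_not_contested h, M.charge_of_not_contested h, sub_zero]

theorem judged_update (hi : i ≠ e₃) :
    Judged E e₃ a (Function.update own i θ) r ↔ Judged E e₃ a own r := by
  simp only [Judged, Function.update_of_ne hi.symm]

theorem mismatch_update : Mismatch E e₃ (Function.update own e₃ θ) r ↔ Mismatch E e₃ own r := by
  refine exists_congr fun j => and_congr_right fun hj => ?_
  rw [Function.update_of_ne hj]

open Classical in
theorem charge_third (h₁ : e₁ ≠ e₃) (h₂ : e₂ ≠ e₃) :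
    M.charge e₁ e₂ e₃ e₃ en p own r =
      if Contested E e₃ (en.getD p) own r ∧ Mismatch E e₃ own r then M.fine else 0 := by
  rw [charge, if_neg h₁.symm, if_neg h₂.symm, if_pos rfl]

/-- `Judged` reads only reports of `e₃`. Penalties rest on it rather than on `Contested` so that
they do not distort the own-type reports of `e₁` and `e₂`. -/
theorem charge_update_of_ne (hi : i ≠ e₃) :
    M.charge e₁ e₂ e₃ i en p (Function.update own i θ) r = M.charge e₁ e₂ e₃ i en p own r := by
  classical
  have h : ∀ a : Proposal F, Judged E e₃ a (Function.update own i θ) r = Judged E e₃ a own r :=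
    fun a => propext (judged_update hi)
  simp only [charge, h, if_neg hi]

/-- At worst a new contest exposes `e₃` to the fine for an existing mismatch. -/
theorem charge_update_le_add_fine (h₁ : e₁ ≠ e₃) (h₂ : e₂ ≠ e₃) :
    M.charge e₁ e₂ e₃ i en p (Function.update own i θ) r ≤
      M.charge e₁ e₂ e₃ i en p own r + M.fine := by
  have := M.fine_pos
  by_cases hi : i = e₃
  · subst hi
    rw [M.charge_third h₁ h₂, M.charge_third h₁ h₂]
    split_ifs <;> linarith
  · rw [M.charge_update_of_ne hi]
    linarith

theorem charge_update_le (h₁ : e₁ ≠ e₃) (h₂ : e₂ ≠ e₃)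
    (h : Contested E e₃ (en.getD p) own r) :
    M.charge e₁ e₂ e₃ i en p (Function.update own i θ) r ≤ M.charge e₁ e₂ e₃ i en p own r := by
  classical
  by_cases hi : i = e₃
  · subst hi
    have := M.fine_pos
    rw [M.charge_third h₁ h₂, M.charge_third h₁ h₂]
    simp only [mismatch_update, h, true_and]
    split_ifs with h1 h2 h2
    · exact le_rfl
    · exact absurd h1.2 h2
    · exact this.le
    · exact le_rfl
  · rw [M.charge_update_of_ne hi]

variable (E) in
/-- The proposal is contested by reports other than agent `i`'s report of his own type. -/
def ContestedByOthers (e₃ i : ι) (a : Proposal F) (own : ι → Θ) (r : Θ) : Prop :=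
  (∃ j ≠ i, E.Objects j a (own j)) ∨ ∃ j ≠ e₃, E.Objects j a r

theorem contested_iff :
    Contested E e₃ a own r ↔ ContestedByOthers E e₃ i a own r ∨ E.Objects i a (own i) := by
  constructor
  · rintro (⟨j, hj⟩ | h)
    · by_cases hji : j = i
      · exact .inr (hji ▸ hj)
      · exact .inl (.inl ⟨j, hji, hj⟩)
    · exact .inl (.inr h)
  · rintro ((⟨j, -, hj⟩ | h) | h)
    · exact .inl ⟨j, hj⟩
    · exact .inr h
    · exact .inl ⟨i, h⟩

theorem contested_update_iff :
    Contested E e₃ a (Function.update own i θ) r ↔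
      ContestedByOthers E e₃ i a own r ∨ E.Objects i a θ := by
  rw [contested_iff (i := i), Function.update_self]
  refine or_congr_left (or_congr_left (exists_congr fun j => and_congr_right fun hj => ?_))
  rw [Function.update_of_ne hj]

/-- Reporting the own type truthfully is strictly optimal, if this or the other report leads to a
contest. -/
theorem value_lt_update (h₁ : e₁ ≠ e₃) (h₂ : e₂ ≠ e₃) (hne : E.typeOf (own i) i ≠ E.typeOf θ i)
    (h : Contested E e₃ (en.getD p) own r ∨
      Contested E e₃ (en.getD p) (Function.update own i θ) r) :
    M.value e₁ e₂ e₃ i θ en p own r <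
      M.value e₁ e₂ e₃ i θ en p (Function.update own i θ) r := by
  unfold value
  have both : Contested E e₃ (en.getD p) own r →
      Contested E e₃ (en.getD p) (Function.update own i θ) r →
      E.u i (M.outcome e₃ (en.getD p) own r) θ - M.charge e₁ e₂ e₃ i en p own r <
      E.u i (M.outcome e₃ (en.getD p) (Function.update own i θ) r) θ -
        M.charge e₁ e₂ e₃ i en p (Function.update own i θ) r := by
    intro hc hc'
    rw [M.outcome_of_contested hc, M.outcome_of_contested hc']
    linarith [M.truth_strict i (en.getD p) own θ hne,
      M.charge_update_le (i := i) (θ := θ) h₁ h₂ hc]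
  -- If the contest does not hinge on agent `i`'s own report, it occurs either way and the contested
  -- outcome rewards truth. Otherwise truth either starts a profitable challenge or drops a costly
  -- false one.
  by_cases ho : ContestedByOthers E e₃ i (en.getD p) own r
  · exact both (contested_iff.2 (.inl ho)) (contested_update_iff.2 (.inl ho))
  have hothers : ∀ j ≠ i, ¬ E.Objects j (en.getD p) (own j) :=
    fun j hj hc => ho (.inl ⟨j, hj, hc⟩)
  by_cases hθ : E.Objects i (en.getD p) θ
  · have hc' : Contested E e₃ (en.getD p) (Function.update own i θ) r :=
      contested_update_iff.2 (.inr hθ)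
    by_cases hown : E.Objects i (en.getD p) (own i)
    · exact both (contested_iff.2 (.inr hown)) hc'
    · have hc : ¬ Contested E e₃ (en.getD p) own r := by
        rw [contested_iff (i := i)]
        tauto
      rw [M.outcome_of_not_contested hc, M.outcome_of_contested hc']
      have h3 := M.challenge_pays i (en.getD p) (Function.update own i θ)
      rw [Function.update_self] at h3
      have h4 := h3 hθ fun j hj => by rw [Function.update_of_ne hj]; exact hothers j hj
      have := M.charge_update_le_add_fine (i := i) (θ := θ) (en := en) (p := p) (own := own)
        (r := r) h₁ h₂
      linarith
  · have hc' : ¬ Contested E e₃ (en.getD p) (Function.update own i θ) r := by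
      rw [contested_update_iff]
      tauto
    have hc := h.resolve_right hc'
    have hown := (contested_iff.1 hc).resolve_left ho
    rw [M.outcome_of_contested hc, M.outcome_of_not_contested hc']
    linarith [M.false_challenge_costs i (en.getD p) own θ hθ hown hothers,
      M.charge_update_le (i := i) (θ := θ) h₁ h₂ hc]

/-- Reporting the own type truthfully is optimal. -/
theorem value_le_update (h₁ : e₁ ≠ e₃) (h₂ : e₂ ≠ e₃) :
    M.value e₁ e₂ e₃ i θ en p own r ≤
      M.value e₁ e₂ e₃ i θ en p (Function.update own i θ) r := by
  by_cases h : Contested E e₃ (en.getD p) own r ∨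
    Contested E e₃ (en.getD p) (Function.update own i θ) r
  · by_cases hne : E.typeOf (own i) i = E.typeOf θ i
    · have hiff : Contested E e₃ (en.getD p) own r ↔
          Contested E e₃ (en.getD p) (Function.update own i θ) r := by
        rw [contested_update_iff, contested_iff (i := i), Environment.Objects,
          Environment.Objects, E.challenges_congr hne]
      rw [← hiff, or_self] at h
      unfold value
      rw [M.outcome_of_contested h, M.outcome_of_contested (hiff.1 h)]
      exact sub_le_sub (M.truth_weak i _ own θ) (M.charge_update_le h₁ h₂ h)
    · exact (M.value_lt_update h₁ h₂ hne h).le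
  · push Not at h
    rw [M.value_of_not_contested h.1, M.value_of_not_contested h.2]

/-- If all agents report their own types truthfully and the selected proposal is contested, then
agent `e₃` strictly prefers to replace a mismatched report by the truth. -/
theorem value_lt_true_cross (h₁ : e₁ ≠ e₃) (h₂ : e₂ ≠ e₃)
    (hown : ∀ j, E.typeOf (own j) j = E.typeOf θ j) (hm : Mismatch E e₃ own r)
    (hc : Contested E e₃ (en.getD p) own r) :
    M.value e₁ e₂ e₃ e₃ θ en p own r < M.value e₁ e₂ e₃ e₃ θ en p own θ := by
  have hκ := M.fine_pos
  have hm' : ¬ Mismatch E e₃ own θ := fun ⟨j, _, hj⟩ => hj (hown j).symm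
  unfold value
  rw [M.charge_third h₁ h₂, M.charge_third h₁ h₂, if_pos ⟨hc, hm⟩, if_neg fun h => hm' h.2,
    M.outcome_of_contested hc]
  by_cases hc' : Contested E e₃ (en.getD p) own θ
  · rw [M.outcome_of_contested hc']
    linarith
  · rw [M.outcome_of_not_contested hc']
    have := M.unchallenged e₃ (en.getD p) own θ fun j hj => hc' (.inl ⟨j, hj⟩)
    linarith

/-- A report that already matches gives the true types of all agents but `e₃`, so replacing it
changes nothing. -/
theorem value_le_true_cross (h₁ : e₁ ≠ e₃) (h₂ : e₂ ≠ e₃)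
    (hown : ∀ j, E.typeOf (own j) j = E.typeOf θ j) (hc : Contested E e₃ (en.getD p) own r) :
    M.value e₁ e₂ e₃ e₃ θ en p own r ≤ M.value e₁ e₂ e₃ e₃ θ en p own θ := by
  by_cases hm : Mismatch E e₃ own r
  · exact (M.value_lt_true_cross h₁ h₂ hown hm hc).le
  · have hm' : ¬ Mismatch E e₃ own θ := fun ⟨j, _, hj⟩ => hj (hown j).symm
    have hc' : Contested E e₃ (en.getD p) own θ := by
      obtain h | ⟨j, hj3, hj⟩ := hc
      · exact .inl h
      · have hr : E.typeOf r j = E.typeOf (own j) j := by_contra fun h => hm ⟨j, hj3, h⟩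
        exact .inr ⟨j, hj3, (E.challenges_congr (hr.trans (hown j))).1 hj⟩
    unfold value
    rw [M.charge_third h₁ h₂, M.charge_third h₁ h₂, if_neg fun h => hm h.2,
      if_neg fun h => hm' h.2, M.outcome_of_contested hc, M.outcome_of_contested hc']

/-- Withdrawing the endorsement of a proposal that `e₃` contests is strictly profitable for
`e₂`. -/
theorem value_lt_withdrawn (h : e₁ ≠ e₂) (hj : Judged E e₃ a own r) :
    M.value e₁ e₂ e₃ e₂ θ (some a) p own r < M.value e₁ e₂ e₃ e₂ θ none p own r := by
  have h1 : M.charge e₁ e₂ e₃ e₂ (some a) p own r = M.penalty := by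
    rw [charge, if_neg h.symm, if_pos rfl, if_pos ⟨a, rfl, hj⟩]
  have h2 : M.charge e₁ e₂ e₃ e₂ none p own r = 0 := by
    rw [charge, if_neg h.symm, if_pos rfl, if_neg (by simp)]
  unfold value
  rw [h1, h2, Option.getD_some, Option.getD_none, M.outcome_of_contested hj.contested]
  by_cases hc : Contested E e₃ p own r
  · rw [M.outcome_of_contested hc]
    linarith [M.penalty_contested e₂ a own p own θ]
  · rw [M.outcome_of_not_contested hc]
    linarith [M.penalty_uncontested e₂ a own p θ]

/-- Replacing a selected proposal that `e₃` contests by an uncontested one is strictly profitable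
for `e₁`. -/
theorem value_lt_replaced {q : Proposal F} (hj : Judged E e₃ p own r)
    (hq : ¬ Contested E e₃ q own r) :
    M.value e₁ e₂ e₃ e₁ θ none p own r < M.value e₁ e₂ e₃ e₁ θ none q own r := by
  have h1 : M.charge e₁ e₂ e₃ e₁ none p own r = M.penalty := by
    rw [charge, if_pos rfl, if_pos ⟨rfl, hj⟩]
  rw [M.value_of_not_contested (en := none) hq, value, h1, Option.getD_none, Option.getD_none,
    M.outcome_of_contested hj.contested]
  linarith [M.penalty_uncontested e₁ p own q θ]

end ContestScheme

/-! ### Modifications in correlated equilibria, and necessity -/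

namespace FiniteMechanism

variable {ι A Θ : Type*} {T : ι → Type*} [DecidableEq ι] {E : Environment ι A Θ T} {θ : Θ}

/-- In a correlated equilibrium, a modification of an agent's messages that never harms him on the
support never benefits him on the support. -/
theorem IsCorrelatedEquilibrium.payoff_update_le [Fintype ι] {M : FiniteMechanism ι A}
    {σ : (∀ i, M.Msg i) → ℝ} (hσ : M.IsCorrelatedEquilibrium E θ σ) (i : ι)
    (φ : M.Msg i → M.Msg i)
    (h : ∀ m, 0 < σ m → M.payoff E θ i m ≤ M.payoff E θ i (Function.update m i (φ (m i))))
    {m : ∀ i, M.Msg i} (hm : 0 < σ m) :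
    M.payoff E θ i (Function.update m i (φ (m i))) ≤ M.payoff E θ i m := by
  classical
  by_contra! hlt
  -- One recommendation suffices: `φ` is constant on profiles sharing the message `m i`, and all
  -- terms of that constraint move weakly in the same direction.
  refine (hσ.2 i (m i) (φ (m i))).not_gt ?_
  refine Finset.sum_lt_sum (fun m' hm' => ?_) ⟨m, by simp, mul_lt_mul_of_pos_left hlt hm⟩
  rw [← (Finset.mem_filter.1 hm').2]
  rcases (hσ.1.1 m').eq_or_lt with h0 | h0
  · rw [← h0, zero_mul, zero_mul]
  · exact mul_le_mul_of_nonneg_left (h m' h0) h0.le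

open Classical in
/-- A pure Nash equilibrium is a degenerate correlated equilibrium. -/
theorem IsPureNash.isCorrelatedEquilibrium [Fintype ι] {M : FiniteMechanism ι A}
    {m : ∀ i, M.Msg i} (h : M.IsPureNash E θ m) :
    M.IsCorrelatedEquilibrium E θ (Pi.single m 1) := by
  refine ⟨single_mem_stdSimplex ℝ m, fun i a b => Finset.sum_le_sum fun m' _ => ?_⟩
  by_cases hm : m' = m
  · subst hm
    simpa using h i b
  · simp [Pi.single_eq_of_ne hm]

end FiniteMechanism

/-- Maskin monotonicity is necessary for implementation. -/
theorem ImplementableInCorrelatedEquilibria.maskinMonotonic {ι A Θ : Type*} {T : ι → Type*}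
    [Fintype ι] [DecidableEq ι] {E : Environment ι A Θ T} {F : Θ → Set (Outcome ι A)}
    (h : ImplementableInCorrelatedEquilibria E F) : MaskinMonotonic E F := by
  classical
  obtain ⟨M, hM⟩ := h
  intro θ' θ z hz hz'
  obtain ⟨m, hNash, rfl, hτ⟩ := (hM θ').1 z hz
  have hnot : ¬ M.IsPureNash E θ m := fun hn =>
    hz' ((hM θ).2 m ⟨_, hn.isCorrelatedEquilibrium, by simp⟩).1
  unfold FiniteMechanism.IsPureNash at hnot
  push Not at hnot
  obtain ⟨i, b, hb⟩ := hnot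
  obtain ⟨z', hz'⟩ := E.exists_shift (M.g (Function.update m i b)) (M.τ i (Function.update m i b))
  have hN := hNash i b
  unfold FiniteMechanism.payoff at hb hN
  rw [hτ, add_zero] at hb hN
  exact ⟨i, z', by rw [hz']; exact hN, by rw [hz']; exact hb⟩

/-! ### The mechanism and its equilibria -/

namespace ContestScheme

variable {ι A Θ : Type*} {T : ι → Type*} [DecidableEq ι] {E : Environment ι A Θ T}
  {F : Θ → Set (Outcome ι A)} (M : ContestScheme E F) (e₁ e₂ e₃ : ι)

/-- The payoff from a profile of messages. -/
noncomputable def profilePayoff (i : ι) (θ : Θ) (μ : ι → Message Θ (Proposal F)) : ℝ :=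
  M.value e₁ e₂ e₃ i θ (endorsed e₂ e₃ fun j => (μ j).endorsement) (μ e₁).proposal
    (fun j => (μ j).own) (μ e₃).cross

/-- The proposal selected at a profile of messages. -/
noncomputable def selected (μ : ι → Message Θ (Proposal F)) : Proposal F :=
  (endorsed e₂ e₃ fun j => (μ j).endorsement).getD (μ e₁).proposal

theorem profilePayoff_update (i k : ι) (θ : Θ) (μ : ι → Message Θ (Proposal F))
    (b : Message Θ (Proposal F)) :
    M.profilePayoff e₁ e₂ e₃ i θ (Function.update μ k b) =
      M.value e₁ e₂ e₃ i θ
        (endorsed e₂ e₃ (Function.update (fun j => (μ j).endorsement) k b.endorsement))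
        (Function.update (fun j => (μ j).proposal) k b.proposal e₁)
        (Function.update (fun j => (μ j).own) k b.own)
        (Function.update (fun j => (μ j).cross) k b.cross e₃) := by
  simp only [← comp_update_apply]
  rfl

variable {e₁ e₂ e₃}

/-- Truth-telling with a common proposal that is desirable in the true state cannot be improved
upon by any single agent. -/
theorem profilePayoff_update_le (h₁₂ : e₁ ≠ e₂) (h₁ : e₁ ≠ e₃) (h₂ : e₂ ≠ e₃) {θ : Θ}
    {a : Proposal F} (ha : a.1.1 = θ) (i : ι) (b : Message Θ (Proposal F)) :
    M.profilePayoff e₁ e₂ e₃ i θ (Function.update (fun _ => ⟨θ, a, some a, θ⟩) i b) ≤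
      E.u i a.1.2 θ := by
  have hobj : ∀ j, ¬ E.Objects j a θ := fun j => ha ▸ E.not_challenges_self j _ _
  rw [profilePayoff_update]
  set en := endorsed e₂ e₃ (Function.update (fun _ => some a) i b.endorsement) with hen
  set p := Function.update (fun _ => a) i b.proposal e₁ with hp
  -- Against a deviation of `e₁` the endorsement stands; a deviation of `e₂` or `e₃` can only void
  -- it, and then the proposal of `e₁` is again `a`.
  have hsel : en.getD p = a := by
    by_cases hi : i = e₁
    · subst hi
      simp [hen, endorsed, Function.update_of_ne h₁₂.symm, Function.update_of_ne h₁.symm]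
    · have : p = a := by rw [hp, Function.update_of_ne (Ne.symm hi)]
      rw [this, hen, endorsed]
      split_ifs with h
      · by_cases hi2 : i = e₂
        · subst hi2
          rw [h, Function.update_of_ne h₂.symm]
          rfl
        · rw [Function.update_of_ne (Ne.symm hi2)]
          rfl
      · rfl
  refine (M.value_le_update h₁ h₂).trans ?_
  rw [Function.update_idem, Function.update_eq_self]
  set r := Function.update (fun _ => θ) i b.cross e₃ with hr
  by_cases hc : Contested E e₃ (en.getD p) (fun _ => θ) r
  · have hm : Mismatch E e₃ (fun _ => θ) r := by
      rw [hsel] at hc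
      obtain ⟨j, hj⟩ | ⟨j, hj3, hj⟩ := hc
      · exact (hobj j hj).elim
      · exact ⟨j, hj3, fun h => hobj j ((E.challenges_congr h).1 hj)⟩
    have hi : i = e₃ := by
      by_contra hi
      obtain ⟨j, -, hj⟩ := hm
      exact hj (by rw [hr, Function.update_of_ne (Ne.symm hi)])
    subst hi
    refine (M.value_lt_true_cross h₁ h₂ (fun _ => rfl) hm hc).le.trans ?_
    rw [M.value_of_not_contested, hsel]
    rw [hsel]
    rintro (⟨j, hj⟩ | ⟨j, -, hj⟩) <;> exact hobj j hj
  · rw [M.value_of_not_contested hc, hsel]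

/-- Profiles in a set with the no-profitable-modification property of supports of correlated
equilibria at `θ` select uncontested proposals to which no agent can object at `θ`. -/
theorem not_contested_of_support (h₁₂ : e₁ ≠ e₂) (h₁ : e₁ ≠ e₃) (h₂ : e₂ ≠ e₃) {θ : Θ}
    (hne : (F θ).Nonempty) {S : Set (ι → Message Θ (Proposal F))}
    (hS : ∀ i (φ : Message Θ (Proposal F) → Message Θ (Proposal F)),
      (∀ μ ∈ S, M.profilePayoff e₁ e₂ e₃ i θ μ ≤
        M.profilePayoff e₁ e₂ e₃ i θ (Function.update μ i (φ (μ i)))) →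
      ∀ μ ∈ S, M.profilePayoff e₁ e₂ e₃ i θ (Function.update μ i (φ (μ i))) ≤
        M.profilePayoff e₁ e₂ e₃ i θ μ)
    {μ : ι → Message Θ (Proposal F)} (hμ : μ ∈ S) :
    ¬ Contested E e₃ (selected e₁ e₂ e₃ μ) (fun j => (μ j).own) (μ e₃).cross ∧
      ∀ j, ¬ E.Objects j (selected e₁ e₂ e₃ μ) θ := by
  classical
  -- Reports of own types.
  have hown : ∀ μ ∈ S, ∀ i, ¬ (E.typeOf (μ i).own i ≠ E.typeOf θ i ∧
      (Contested E e₃ (selected e₁ e₂ e₃ μ) (fun j => (μ j).own) (μ e₃).cross ∨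
        Contested E e₃ (selected e₁ e₂ e₃ μ) (Function.update (fun j => (μ j).own) i θ)
          (μ e₃).cross)) := by
    intro μ hμ i ⟨hne, hc⟩
    have hupd : ∀ μ : ι → Message Θ (Proposal F),
        M.profilePayoff e₁ e₂ e₃ i θ (Function.update μ i { μ i with own := θ }) =
        M.value e₁ e₂ e₃ i θ (endorsed e₂ e₃ fun j => (μ j).endorsement) (μ e₁).proposal
          (Function.update (fun j => (μ j).own) i θ) (μ e₃).cross := by
      intro μ
      rw [profilePayoff_update]
      simp only [Function.update_eq_self]
    refine (hS i (fun b => { b with own := θ }) (fun μ _ => ?_) μ hμ).not_gt ?_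
    · rw [hupd]
      exact M.value_le_update h₁ h₂
    · rw [hupd]
      exact M.value_lt_update h₁ h₂ hne hc
  have htrue : ∀ μ ∈ S, Contested E e₃ (selected e₁ e₂ e₃ μ) (fun j => (μ j).own) (μ e₃).cross →
      ∀ j, E.typeOf (μ j).own j = E.typeOf θ j :=
    fun μ hμ hc j => by_contra fun hj => hown μ hμ j ⟨hj, .inl hc⟩
  -- A true objector to an uncontested proposal must have misreported, and telling the truth would
  -- start a contest.
  have hgood : ∀ μ ∈ S,
      ¬ Contested E e₃ (selected e₁ e₂ e₃ μ) (fun j => (μ j).own) (μ e₃).cross →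
      ∀ j, ¬ E.Objects j (selected e₁ e₂ e₃ μ) θ := by
    intro μ hμ hc j hj
    refine hown μ hμ j ⟨fun h => hc (.inl ⟨j, (E.challenges_congr h).2 hj⟩), .inr ?_⟩
    exact .inl ⟨j, by rwa [Function.update_self]⟩
  -- The report of `e₃` about the other agents.
  have hcross : ∀ μ ∈ S, Contested E e₃ (selected e₁ e₂ e₃ μ) (fun j => (μ j).own) (μ e₃).cross →
      ¬ Mismatch E e₃ (fun j => (μ j).own) (μ e₃).cross := by
    intro μ hμ hc hm
    have hupd : ∀ μ : ι → Message Θ (Proposal F),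
        M.profilePayoff e₁ e₂ e₃ e₃ θ (Function.update μ e₃ { μ e₃ with cross := θ }) =
        M.value e₁ e₂ e₃ e₃ θ (endorsed e₂ e₃ fun j => (μ j).endorsement) (μ e₁).proposal
          (fun j => (μ j).own) θ := by
      intro μ
      rw [profilePayoff_update]
      simp only [Function.update_eq_self, Function.update_self]
    refine (hS e₃ (fun b => { b with cross := θ }) (fun μ hμ => ?_) μ hμ).not_gt ?_
    · rw [hupd]
      by_cases hc : Contested E e₃ (selected e₁ e₂ e₃ μ) (fun j => (μ j).own) (μ e₃).cross
      · exact M.value_le_true_cross h₁ h₂ (htrue μ hμ hc) hc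
      · rw [M.value_of_not_contested, profilePayoff, M.value_of_not_contested hc]
        rintro (⟨j, hj⟩ | ⟨j, -, hj⟩)
        · exact hc (.inl ⟨j, hj⟩)
        · exact hgood μ hμ hc j hj
    · rw [hupd]
      exact M.value_lt_true_cross h₁ h₂ (htrue μ hμ hc) hm hc
  have hobj : ∀ μ ∈ S, Contested E e₃ (selected e₁ e₂ e₃ μ) (fun j => (μ j).own) (μ e₃).cross →
      ∀ a : Proposal F, (∃ j, E.Objects j a θ) ↔
        Judged E e₃ a (fun j => (μ j).own) (μ e₃).cross := by
    intro μ hμ hc a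
    have hr : ∀ j ≠ e₃, E.typeOf (μ e₃).cross j = E.typeOf θ j := fun j hj =>
      (by_contra fun h => hcross μ hμ hc ⟨j, hj, h⟩ : E.typeOf (μ e₃).cross j = _).trans
        (htrue μ hμ hc j)
    constructor
    · rintro ⟨j, hj⟩
      by_cases hj3 : j = e₃
      · subst hj3
        exact .inl ((E.challenges_congr (htrue μ hμ hc j)).2 hj)
      · exact .inr ⟨j, hj3, (E.challenges_congr (hr j hj3)).2 hj⟩
    · rintro (hj | ⟨j, hj3, hj⟩)
      · exact ⟨e₃, (E.challenges_congr (htrue μ hμ hc e₃)).1 hj⟩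
      · exact ⟨j, (E.challenges_congr (hr j hj3)).1 hj⟩
  have hjudged : ∀ μ ∈ S, (∃ j, E.Objects j (selected e₁ e₂ e₃ μ) θ) →
      Judged E e₃ (selected e₁ e₂ e₃ μ) (fun j => (μ j).own) (μ e₃).cross := by
    intro μ hμ hbad
    have hc : Contested E e₃ (selected e₁ e₂ e₃ μ) (fun j => (μ j).own) (μ e₃).cross := by
      by_contra hc
      obtain ⟨j, hj⟩ := hbad
      exact hgood μ hμ hc j hj
    exact (hobj μ hμ hc _).1 hbad
  have hbad : ∀ μ ∈ S, Contested E e₃ (selected e₁ e₂ e₃ μ) (fun j => (μ j).own) (μ e₃).cross →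
      ∃ j, E.Objects j (selected e₁ e₂ e₃ μ) θ := by
    intro μ hμ hc
    obtain ⟨j, hj⟩ | ⟨j, hj3, hj⟩ := id hc
    · exact ⟨j, (E.challenges_congr (htrue μ hμ hc j)).1 hj⟩
    · exact (hobj μ hμ hc _).2 (.inr ⟨j, hj3, hj⟩)
  -- The endorsement of `e₂`.
  have hendorse : ∀ μ ∈ S, ∀ a, endorsed e₂ e₃ (fun j => (μ j).endorsement) = some a →
      ¬ ∃ j, E.Objects j a θ := by
    intro μ hμ a hen ha
    -- The modification sees only the message of `e₂`, so it withdraws every objectionable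
    -- endorsement; this matters only when `e₃` endorses the same proposal.
    let φ : Message Θ (Proposal F) → Message Θ (Proposal F) := fun b =>
      { b with endorsement :=
          if ∃ a, b.endorsement = some a ∧ ∃ j, E.Objects j a θ then none else b.endorsement }
    have hφ : ∀ b, (φ b).endorsement =
      if ∃ a, b.endorsement = some a ∧ ∃ j, E.Objects j a θ then none else b.endorsement :=
      fun _ => rfl
    have hupd : ∀ μ : ι → Message Θ (Proposal F),
        M.profilePayoff e₁ e₂ e₃ e₂ θ (Function.update μ e₂ (φ (μ e₂))) =
        M.value e₁ e₂ e₃ e₂ θ (if ∃ a, endorsed e₂ e₃ (fun j => (μ j).endorsement) = some a ∧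
          ∃ j, E.Objects j a θ then none else endorsed e₂ e₃ fun j => (μ j).endorsement)
          (μ e₁).proposal (fun j => (μ j).own) (μ e₃).cross := by
      intro μ
      have hen : endorsed e₂ e₃
          (Function.update (fun j => (μ j).endorsement) e₂ (φ (μ e₂)).endorsement) =
          if ∃ a, endorsed e₂ e₃ (fun j => (μ j).endorsement) = some a ∧
            ∃ j, E.Objects j a θ then none else endorsed e₂ e₃ fun j => (μ j).endorsement := by
        rw [hφ]
        unfold endorsed
        rw [Function.update_self, Function.update_of_ne h₂.symm]
        by_cases hb : ∃ a, (μ e₂).endorsement = some a ∧ ∃ j, E.Objects j a θ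
        · rw [if_pos hb, ite_self]
          by_cases heq : (μ e₂).endorsement = (μ e₃).endorsement
          · simp only [if_pos heq, if_pos hb]
          · simp [if_neg heq]
        · simp only [if_neg hb]
          by_cases heq : (μ e₂).endorsement = (μ e₃).endorsement
          · simp only [if_pos heq, if_neg hb]
          · simp [if_neg heq]
      rw [profilePayoff_update, hen]
      simp only [φ, Function.update_eq_self]
    have hlt : ∀ μ ∈ S, (∃ a, endorsed e₂ e₃ (fun j => (μ j).endorsement) = some a ∧
        ∃ j, E.Objects j a θ) → M.profilePayoff e₁ e₂ e₃ e₂ θ μ <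
          M.profilePayoff e₁ e₂ e₃ e₂ θ (Function.update μ e₂ (φ (μ e₂))) := by
      rintro μ hμ ⟨a, hen, ha⟩
      have hsel : selected e₁ e₂ e₃ μ = a := by rw [selected, hen, Option.getD_some]
      rw [hupd, if_pos ⟨a, hen, ha⟩, profilePayoff, hen]
      exact M.value_lt_withdrawn h₁₂ (hsel ▸ hjudged μ hμ (hsel ▸ ha))
    refine (hS e₂ φ (fun μ hμ => ?_) μ hμ).not_gt (hlt μ hμ ⟨a, hen, ha⟩)
    by_cases h : ∃ a, endorsed e₂ e₃ (fun j => (μ j).endorsement) = some a ∧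
      ∃ j, E.Objects j a θ
    · exact (hlt μ hμ h).le
    · rw [hupd, if_neg h, profilePayoff]
  -- The proposal of `e₁`.
  have hpropose : ∀ μ ∈ S, endorsed e₂ e₃ (fun j => (μ j).endorsement) = none →
      ¬ ∃ j, E.Objects j (μ e₁).proposal θ := by
    intro μ hμ hen ha
    obtain ⟨x, hx⟩ := hne
    let q : Proposal F := ⟨(θ, x), hx⟩
    let φ : Message Θ (Proposal F) → Message Θ (Proposal F) := fun b =>
      { b with proposal := if ∃ j, E.Objects j b.proposal θ then q else b.proposal }
    have hupd : ∀ μ : ι → Message Θ (Proposal F),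
        M.profilePayoff e₁ e₂ e₃ e₁ θ (Function.update μ e₁ (φ (μ e₁))) =
        M.value e₁ e₂ e₃ e₁ θ (endorsed e₂ e₃ fun j => (μ j).endorsement)
          (if ∃ j, E.Objects j (μ e₁).proposal θ then q else (μ e₁).proposal)
          (fun j => (μ j).own) (μ e₃).cross := by
      intro μ
      rw [profilePayoff_update]
      simp only [φ, Function.update_eq_self, Function.update_self]
    have hlt : ∀ μ ∈ S, endorsed e₂ e₃ (fun j => (μ j).endorsement) = none →
        (∃ j, E.Objects j (μ e₁).proposal θ) → M.profilePayoff e₁ e₂ e₃ e₁ θ μ <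
          M.profilePayoff e₁ e₂ e₃ e₁ θ (Function.update μ e₁ (φ (μ e₁))) := by
      intro μ hμ hen ha
      have hsel : selected e₁ e₂ e₃ μ = (μ e₁).proposal := by
        rw [selected, hen, Option.getD_none]
      have hj := hjudged μ hμ (hsel ▸ ha)
      rw [hupd, if_pos ha, profilePayoff, hen]
      refine M.value_lt_replaced (hsel ▸ hj) ?_
      have hq : ¬ Judged E e₃ q (fun j => (μ j).own) (μ e₃).cross := by
        rw [← hobj μ hμ hj.contested]
        rintro ⟨j, hj⟩
        exact E.not_challenges_self _ _ _ hj
      rintro (⟨j, hj'⟩ | h)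
      · exact E.not_challenges_self _ _ _
          ((E.challenges_congr (htrue μ hμ hj.contested j)).1 hj')
      · exact hq (.inr h)
    refine (hS e₁ φ (fun μ hμ => ?_) μ hμ).not_gt (hlt μ hμ hen ha)
    by_cases h : ∃ j, E.Objects j (μ e₁).proposal θ
    · cases hen : endorsed e₂ e₃ fun j => (μ j).endorsement with
      | none => exact (hlt μ hμ hen h).le
      | some a =>
        rw [hupd, profilePayoff, hen]
        have hsel : selected e₁ e₂ e₃ μ = a := by rw [selected, hen, Option.getD_some]
        -- An endorsement that takes effect is already known to be uncontested, so the proposal of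
        -- `e₁` does not affect his payoff.
        have hc : ¬ Contested E e₃ a (fun j => (μ j).own) (μ e₃).cross := fun hc =>
          hendorse μ hμ a hen (hsel ▸ hbad μ hμ (hsel.symm ▸ hc))
        rw [M.value_of_not_contested (en := some a) hc,
          M.value_of_not_contested (en := some a) hc, Option.getD_some, Option.getD_some]
    · rw [hupd, if_neg h, profilePayoff]
  have hnot : ¬ Contested E e₃ (selected e₁ e₂ e₃ μ) (fun j => (μ j).own) (μ e₃).cross := by
    intro hc
    have hb := hbad μ hμ hc
    cases hen : endorsed e₂ e₃ fun j => (μ j).endorsement with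
    | none =>
      refine hpropose μ hμ hen ?_
      rwa [selected, hen, Option.getD_none] at hb
    | some a =>
      refine hendorse μ hμ a hen ?_
      rwa [selected, hen, Option.getD_some] at hb
  exact ⟨hnot, hgood μ hμ hnot⟩

variable (e₁ e₂ e₃) in
/-- The mechanism in which messages are coded by a finite type `C`. -/
noncomputable def mechanism (C : Type) [Fintype C] [Nonempty C]
    (e : C ≃ Message Θ (Proposal F)) : FiniteMechanism ι A where
  Msg _ := C
  g m := M.outcome e₃ (selected e₁ e₂ e₃ fun j => e (m j)) (fun j => (e (m j)).own)
    (e (m e₃)).cross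
  τ i m := - M.charge e₁ e₂ e₃ i (endorsed e₂ e₃ fun j => (e (m j)).endorsement)
    (e (m e₁)).proposal (fun j => (e (m j)).own) (e (m e₃)).cross

theorem mechanism_payoff (C : Type) [Fintype C] [Nonempty C] (e : C ≃ Message Θ (Proposal F))
    (θ : Θ) (i : ι) (m : ι → C) :
    (M.mechanism e₁ e₂ e₃ C e).payoff E θ i m =
      M.profilePayoff e₁ e₂ e₃ i θ fun j => e (m j) :=
  (sub_eq_add_neg _ _).symm

theorem mechanism_payoff_update (C : Type) [Fintype C] [Nonempty C]
    (e : C ≃ Message Θ (Proposal F)) (θ : Θ) (i : ι) (m : ι → C) (b : C) :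
    (M.mechanism e₁ e₂ e₃ C e).payoff E θ i
        (Function.update (β := (M.mechanism e₁ e₂ e₃ C e).Msg) m i b) =
      M.profilePayoff e₁ e₂ e₃ i θ (Function.update (fun j => e (m j)) i (e b)) :=
  (M.mechanism_payoff C e θ i _).trans
    (congrArg (M.profilePayoff e₁ e₂ e₃ i θ) (comp_update_apply (fun c => e c) m i b))

/-- The mechanism implements every Maskin monotonic correspondence. -/
theorem mechanism_implements [Fintype ι] (hF : MaskinMonotonic E F) (hne : ∀ θ, (F θ).Nonempty)
    (h₁₂ : e₁ ≠ e₂) (h₁ : e₁ ≠ e₃) (h₂ : e₂ ≠ e₃) (C : Type) [Fintype C] [Nonempty C]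
    (e : C ≃ Message Θ (Proposal F)) : (M.mechanism e₁ e₂ e₃ C e).Implements E F := by
  intro θ
  have key : ∀ m : ι → C, ¬ Contested E e₃ (selected e₁ e₂ e₃ fun j => e (m j))
      (fun j => (e (m j)).own) (e (m e₃)).cross →
      (M.mechanism e₁ e₂ e₃ C e).g m = (selected e₁ e₂ e₃ fun j => e (m j)).1.2 ∧
      ∀ i, (M.mechanism e₁ e₂ e₃ C e).τ i m = 0 := fun m hc =>
    ⟨M.outcome_of_not_contested hc, fun i => neg_eq_zero.2 (M.charge_of_not_contested hc)⟩
  refine ⟨fun x hx => ?_, ?_⟩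
  · let a : Proposal F := ⟨(θ, x), hx⟩
    let m : ι → C := fun _ => e.symm ⟨θ, a, some a, θ⟩
    have hem : (fun j => e (m j)) = fun _ => ⟨θ, a, some a, θ⟩ :=
      funext fun _ => e.apply_symm_apply _
    have hsel : (selected e₁ e₂ e₃ fun j => e (m j)) = a := by
      rw [hem]
      simp [selected, endorsed]
    have hc : ¬ Contested E e₃ (selected e₁ e₂ e₃ fun j => e (m j))
        (fun j => (e (m j)).own) (e (m e₃)).cross := by
      rw [hsel]
      simp only [m, Equiv.apply_symm_apply]
      rintro (⟨j, hj⟩ | ⟨j, -, hj⟩) <;> exact E.not_challenges_self _ _ _ hj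
    have hkey := key m hc
    rw [hsel] at hkey
    refine ⟨m, fun i b => ?_, hkey⟩
    have hpay : (M.mechanism e₁ e₂ e₃ C e).payoff E θ i m = E.u i a.1.2 θ :=
      (M.mechanism_payoff C e θ i m).trans ((M.value_of_not_contested hc).trans
        (congrArg (fun a : Proposal F => E.u i a.1.2 θ) hsel))
    have hle : M.profilePayoff e₁ e₂ e₃ i θ (Function.update (fun j => e (m j)) i (e b)) ≤
        E.u i a.1.2 θ := by
      rw [hem]
      exact M.profilePayoff_update_le h₁₂ h₁ h₂ (a := a) rfl i (e b)
    exact ((M.mechanism_payoff_update C e θ i m b).trans_le hle).trans_eq hpay.symm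
  · rintro m ⟨σ, hσ, hm⟩
    have hsupp := M.not_contested_of_support h₁₂ h₁ h₂ (hne θ)
      (S := {μ | 0 < σ fun j => e.symm (μ j)}) ?_ (μ := fun j => e (m j)) ?_
    · have hkey := key m hsupp.1
      refine ⟨?_, hkey.2⟩
      rw [hkey.1]
      by_contra hx
      -- Monotonicity between the proposed state and `θ` yields exactly an objection at `θ`.
      obtain ⟨i, z, h1, h2⟩ := hF _ θ _ (selected e₁ e₂ e₃ fun j => e (m j)).2 hx
      exact hsupp.2 i ⟨z, h1, h2⟩
    · intro i φ h μ hμ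
      have hweak : ∀ m : ι → C, 0 < σ m → M.profilePayoff e₁ e₂ e₃ i θ (fun j => e (m j)) ≤
          M.profilePayoff e₁ e₂ e₃ i θ
            (Function.update (fun j => e (m j)) i (e (e.symm (φ (e (m i)))))) := by
        intro m hm
        rw [Equiv.apply_symm_apply]
        refine h (fun j => e (m j)) ?_
        simpa only [Set.mem_ofPred_eq, Equiv.symm_apply_apply] using hm
      have hstable : M.profilePayoff e₁ e₂ e₃ i θ
          (Function.update (fun j => e (e.symm (μ j))) i (e (e.symm (φ (e (e.symm (μ i))))))) ≤
          M.profilePayoff e₁ e₂ e₃ i θ (fun j => e (e.symm (μ j))) :=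
        (M.mechanism_payoff_update C e θ i _ _).symm.trans_le
          ((hσ.payoff_update_le i (fun c => e.symm (φ (e c))) (fun m' hm' =>
            (hweak m' hm').trans_eq (M.mechanism_payoff_update C e θ i _ _).symm) hμ).trans_eq
              (M.mechanism_payoff C e θ i _))
      simpa only [Equiv.apply_symm_apply] using hstable
    · have hm' : (fun j => e.symm (e (m j))) = m := funext fun j => e.symm_apply_apply (m j)
      exact hm.trans_eq (congrArg σ hm').symm

end ContestScheme

theorem theorem2 {ι A Θ : Type*} {T : ι → Type*} [Fintype ι] [DecidableEq ι] [Nonempty A]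
    [Finite Θ] (hι : 3 ≤ Fintype.card ι) (E : Environment ι A Θ T)
    (F : Θ → Set (Outcome ι A)) (hfin : ∀ θ, (F θ).Finite) (hne : ∀ θ, (F θ).Nonempty) :
    ImplementableInCorrelatedEquilibria E F ↔ MaskinMonotonic E F := by
  refine ⟨fun h => h.maskinMonotonic, fun hF => ?_⟩
  cases isEmpty_or_nonempty Θ with
  | inl h =>
    exact ⟨{ Msg := fun _ => Unit
             g := fun _ => (PMF.pure (Classical.arbitrary A), 0)
             τ := fun _ _ => 0 }, fun θ => h.elim θ⟩
  | inr h =>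
    obtain ⟨e₁, e₂, e₃, h₁₂, h₁, h₂⟩ := Fintype.two_lt_card_iff.1 hι
    have : Nonempty ι := ⟨e₁⟩
    have := Proposal.finite hfin
    obtain ⟨M⟩ := ContestScheme.nonempty E hfin
    obtain ⟨x, hx⟩ := hne h.some
    -- Message sets must lie in `Type`, while `Message` lives in the universes of `Θ` and the
    -- outcomes; hence the coding by `Fin n`.
    obtain ⟨n, ⟨e⟩⟩ := Finite.exists_equiv_fin (Message Θ (Proposal F))
    have : Nonempty (Fin n) := ⟨e ⟨h.some, ⟨(h.some, x), hx⟩, none, h.some⟩⟩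
    exact ⟨_, M.mechanism_implements hF hne h₁₂ h₁ h₂ (Fin n) e.symm⟩
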